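/- **Model.** There are $N\ge 2$ users (indices cyclic, $i\pm1$ modulo $N$), $T\ge 1$ time slots and $L$ linear constraints. User $i$ has utility $\sum_t v^i_t(x^i_t)$ for the demand $x^i=(x^i_t)_t$. Given are unit prices $p_t\in\mathbb R$, a unit peak price $p_0\in\mathbb R$, a matrix $A=(a^{i,l}_t)\in\mathbb R^{L\times NT}$ and $b\in\mathbb R^L$, $b\ge 0$, such that $\mathcal X=\{x\in\mathbb R^{NT}: Ax\le b\}$ is bounded. The problem is to maximize $f(x)-p_0w$, where $f(x)=\sum_{i,t}\big(v^i_t(x^i_t)-p_tx^i_t\big)$, over $(x,w)$ subject to $Ax\le b$ and $\sum_i x^i_t\le w$ for all $t$. An *optimal price vector* is a solution $(\lambda,\mu)\in\mathbb R^L\times\mathbb R^T$ of its Lagrangian dual: it minimizes $\sup_{x,w}\{f(x)-p_0w-\sum_l\lambda^l((Ax)_l-b^l)-\sum_t\mu_t(\sum_ix^i_t-w)\}$ over $(\lambda,\mu)\ge 0$. Let $\tilde A=\binom{A}{\mathbf 1_N^{\mathsf T}\otimes I_T}$, with spectral norm $\|\tilde A\|$. **Assumptions.** For some $\delta>0$ every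 $v^i_t:\mathbb R\to\mathbb R\cup\{-\infty\}$ is finite exactly on an open interval (possibly $\mathbb R$), and is twice differentiable and $\delta$-strongly concave there. There are $\underline r^i_t,\bar r^i_t\in\mathbb R$ such that for every $x\in\mathcal X$ the marginal utility $\dot v^i_t(x^i_t)$ exists and lies in $[\underline r^i_t,\bar r^i_t]$, and every $r\in[\underline r^i_t,\bar r^i_t]$ equals $\dot v^i_t(x)$ for some $x$. Let $$\mathcal P=\{\tilde\lambda=(\lambda,\mu)\ge0:\ \underline r^i_t\le(\tilde A^{\mathsf T}\tilde\lambda)^i_t+p_t\le\bar r^i_t\ \ \forall i,t,\ \ \textstyle\sum_t\mu_t=p_0\}.$$ **Mechanism.** User $i$ sends $m^i=(y^i,q^i,s^i,\beta^i)\in\mathbb R^T\times\mathbb R^L_{\ge0}\times\mathbb R^T_{\ge0}\times\mathbb R^T$, receives the demand $y^i$ and has payoff $\sum_tv^i_t(y^i_t)-\hat t^i(m)$ with tax $$\hat t^i(m)=\sum_t(p_t+\mathcal{RP}_t(s^{-i},\zeta^{-i}))y^i_t+\sum_{l}q^{-i,l}\sum_ta^{i,l}_ty^i_t+\sum_t(\beta^i_t-y^{i+1}_t)^2$$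 $$+\sum_l\Big[(q^{i,l}-q^{-i,l})^2+q^{i,l}\Big(b^l-\sum_{j\ne i}\sum_ta^{j,l}_ty^j_t-\sum_ta^{i,l}_t\beta^{i-1}_t\Big)\Big]+\sum_t\big[(s^i_t-s^{-i}_t)^2+s^i_t(\max_{t'}\zeta^{-i}_{t'}-\zeta^{-i}_t)\big],$$ where $q^{-i,l},s^{-i}_t$ are the averages of $q^{j,l},s^j_t$ over $j\ne i$, $\zeta^{-i}_t=\sum_{j\ne i}y^j_t+\beta^{i-1}_t$, and $\mathcal{RP}_t(s,\zeta)=p_0s_t/\sum_{t'}s_{t'}$ if $s\ne0$, while $\mathcal{RP}(0,\zeta)$ divides $p_0$ equally among the maximizers of $t\mapsto\zeta_t$ and is $0$ at the other $t$. NE means pure Nash equilibrium of the resulting game. **Learning algorithm** (initial prices $(q^0,s^0)\in\mathcal P$, step size $\alpha$, at most $K$ iterations). Put $(q^i(0),s^i(0))=(q^0,s^0)$ for all $i$, and always $y^i_t(k)=(\dot v^i_t)^{-1}\big(p_t+\sum_la^{i,l}_tq^{i,l}(k)+s^i_t(k)\big)$. In each iteration, for each user $i$, $$(q^i(k+1),s^i(k+1))=\mathrm{Proj}_{\mathcal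 P}\Big(\big(q^{i,l}(k)-\alpha(b^l-(Ay(k))_l)\big)_l,\ \big(s^i_t(k)+\alpha\textstyle\sum_jy^j_t(k)\big)_t\Big),$$ with $\mathrm{Proj}_{\mathcal P}$ the Euclidean projection, stopping early if an iteration changes nothing. The output $m(K)$ consists of the last $y,q,s$ and $\beta^i=y^{i+1}$. **Theorem.** Let $f$ be $\delta'$-strongly concave on its domain, $\delta'>0$, and let $0<\alpha<2\delta'/\|\tilde A\|^2$. Then, for every user $i$ and every optimal price vector $(q^*,s^*)$, the Euclidean distance from the price vector $(q^i(K),s^i(K))$ to $(q^*,s^*)$ is non-increasing in $K$. Furthermore, $\lim_{K\to\infty}m(K)=m^*$ for some NE $m^*$, in which all users announce one and the same price vector, and this is an optimal price vector. -/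

import Mathlib

open scoped Matrix

/-- The data of an energy community with `N` users, `T` time slots and `L` linear constraints.
The utility of user `i` at time `t` is the extended-valued function that equals `v i t` on its
effective domain `dom i t` and `-∞` outside it (`dom i t = Set.univ` is the everywhere finite
case). The unit prices are `p`, the unit peak price is `p0`, and the feasible set of demands is
`{x | A x ≤ b}`. -/
structure EnergyCommunity (N T L : ℕ) where
  v : Fin N → Fin T → ℝ → ℝ
  dom : Fin N → Fin T → Set ℝ
  p : Fin T → ℝ
  p0 : ℝ
  A : Matrix (Fin L) (Fin N × Fin T) ℝ
  b : Fin L → ℝ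

/-- Demand vectors `x = (x i t)`, with the Euclidean norm. -/
abbrev Alloc (N T : ℕ) := EuclideanSpace ℝ (Fin N × Fin T)

/-- Price vectors `(λ, μ)`: one price per constraint (`Sum.inl l`), one peak price per time slot
(`Sum.inr t`), with the Euclidean norm. -/
abbrev Price (T L : ℕ) := EuclideanSpace ℝ (Fin L ⊕ Fin T)

/-- A message of one user: demand `y`, constraint prices `q`, peak prices `s`, and the proxy `β`
for the demand of the next user. -/
abbrev Msg (T L : ℕ) := (Fin T → ℝ) × (Fin L → ℝ) × (Fin T → ℝ) × (Fin T → ℝ)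

namespace Msg

variable {T L : ℕ}

def y (m : Msg T L) : Fin T → ℝ := m.1
def q (m : Msg T L) : Fin L → ℝ := m.2.1
def s (m : Msg T L) : Fin T → ℝ := m.2.2.1
def β (m : Msg T L) : Fin T → ℝ := m.2.2.2

/-- The message space: suggested prices are nonnegative. -/
def Admissible (m : Msg T L) : Prop := (∀ l, 0 ≤ m.q l) ∧ ∀ t, 0 ≤ m.s t

end Msg

/-- Message profiles, with the product topology. -/
abbrev Profile (N T L : ℕ) := Fin N → Msg T L

/-- The state of the learning algorithm: each user's suggested price vector and demand. -/
structure LearnState (N T L : ℕ) where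
  price : Fin N → Price T L
  demand : Fin N → Fin T → ℝ

/-- The Euclidean projection onto `S`, i.e. the point of `S` nearest to `x` (for the nonempty closed
convex sets to which it is applied this point exists and is unique). -/
noncomputable def euclideanProj {E : Type*} [NormedAddCommGroup E] (S : Set E) (x : E) : E :=
  Classical.epsilon fun z => z ∈ S ∧ ∀ z' ∈ S, dist x z ≤ dist x z'

namespace EnergyCommunity

variable {N T L : ℕ} (C : EnergyCommunity N T L)

/-! ### The demand management problem and its dual -/

/-- The feasible set `{x | A x ≤ b}`. -/
def feasible : Set (Alloc N T) := {x | ∀ l, (C.A *ᵥ x.ofLp) l ≤ C.b l}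

/-- The demand vectors at which all utilities are finite. -/
def allocDom : Set (Alloc N T) := {x | ∀ i t, x (i, t) ∈ C.dom i t}

/-- The utilities minus the energy cost without the peak charge. -/
def objective (x : Alloc N T) : ℝ := ∑ i, ∑ t, (C.v i t (x (i, t)) - C.p t * x (i, t))

/-- The Lagrangian of: maximize `objective x - p0 * w` subject to `A x ≤ b` and
`∑ i, x i t ≤ w` for all `t`. -/
def lagrangian (π : Price T L) (x : Alloc N T) (w : ℝ) : ℝ :=
  C.objective x - C.p0 * w - ∑ l, π (Sum.inl l) * ((C.A *ᵥ x.ofLp) l - C.b l)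
    - ∑ t, π (Sum.inr t) * (∑ i, x (i, t) - w)

/-- The dual function. -/
noncomputable def dual (π : Price T L) : EReal :=
  ⨆ x ∈ C.allocDom, ⨆ w : ℝ, (C.lagrangian π x w : EReal)

/-- An optimal price vector: a solution of the dual problem, minimize `dual` over `π ≥ 0`. -/
def IsOptimalPrice (π : Price T L) : Prop :=
  (∀ j, 0 ≤ π j) ∧ ∀ π' : Price T L, (∀ j, 0 ≤ π' j) → C.dual π ≤ C.dual π'

/-- The matrix `Ã` of all constraints: `A` stacked on `1ᵀ ⊗ I`. -/
def Atilde : Matrix (Fin L ⊕ Fin T) (Fin N × Fin T) ℝ :=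
  Matrix.fromRows C.A (Matrix.of fun t j => if j.2 = t then 1 else 0)

/-- The spectral norm of `Ã`. -/
noncomputable def normAtilde : ℝ :=
  ‖LinearMap.toContinuousLinearMap (Matrix.toEuclideanLin C.Atilde)‖

/-! ### Assumptions -/

/-- The utilities are twice differentiable and `δ`-strongly concave on their open domains, and the
feasible set is a polytope `{x | A x ≤ b}` with `b ≥ 0`. -/
structure Standing (δ : ℝ) : Prop where
  isOpen_dom : ∀ i t, IsOpen (C.dom i t)
  differentiable : ∀ i t, DifferentiableOn ℝ (C.v i t) (C.dom i t)
  twice_differentiable : ∀ i t, DifferentiableOn ℝ (deriv (C.v i t)) (C.dom i t)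
  strongConcave : ∀ i t, StrongConcaveOn (C.dom i t) δ (C.v i t)
  b_nonneg : ∀ l, 0 ≤ C.b l
  bounded : Bornology.IsBounded C.feasible

/-- The numbers `rlo i t`, `rhi i t` bound the marginal utilities over the feasible set (where the
utilities are in particular finite), and every number between them is a marginal utility. -/
structure PriceBounds (rlo rhi : Fin N → Fin T → ℝ) : Prop where
  mem_Icc : ∀ x ∈ C.feasible, ∀ i t,
    x (i, t) ∈ C.dom i t ∧ deriv (C.v i t) (x (i, t)) ∈ Set.Icc (rlo i t) (rhi i t)
  exists_eq : ∀ i t, ∀ r ∈ Set.Icc (rlo i t) (rhi i t), ∃ x ∈ C.dom i t, deriv (C.v i t) x = r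

/-- The set `𝒫` of proper prices. -/
def properPrices (rlo rhi : Fin N → Fin T → ℝ) : Set (Price T L) :=
  {π | (∀ j, 0 ≤ π j) ∧
    (∀ i t, (C.Atildeᵀ *ᵥ π.ofLp) (i, t) + C.p t ∈ Set.Icc (rlo i t) (rhi i t)) ∧
    ∑ t, π (Sum.inr t) = C.p0}

/-! ### The mechanism and its game; the successor of user `i` is `finRotate N i` -/

/-- `s^{-i}`: the average of the peak prices suggested by the other users. -/
noncomputable def sOthers (m : Profile N T L) (i : Fin N) (t : Fin T) : ℝ :=
  (∑ j ∈ Finset.univ.erase i, (m j).s t) / ((N : ℝ) - 1)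

/-- `q^{-i}`: the average of the constraint prices suggested by the other users. -/
noncomputable def qOthers (m : Profile N T L) (i : Fin N) (l : Fin L) : ℝ :=
  (∑ j ∈ Finset.univ.erase i, (m j).q l) / ((N : ℝ) - 1)

/-- The proxy for user `i`'s demand, announced by her predecessor. -/
def proxy (m : Profile N T L) (i : Fin N) : Fin T → ℝ := (m ((finRotate N).symm i)).β

/-- `ζ^{-i}`: total demand, with user `i`'s own demand replaced by the proxy. -/
def zeta (m : Profile N T L) (i : Fin N) (t : Fin T) : ℝ :=
  ∑ j ∈ Finset.univ.erase i, (m j).y t + proxy m i t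

open Classical in
/-- The radial pricing operator. -/
noncomputable def radialPrice (s y : Fin T → ℝ) (t : Fin T) : ℝ :=
  if s ≠ 0 then s t / (∑ t', s t') * C.p0
  else if ∀ t', y t' ≤ y t then
    C.p0 / ((Finset.univ.filter fun u : Fin T => ∀ t', y t' ≤ y u).card : ℝ)
  else 0

/-- The tax of user `i`; the demand allocated to user `j` is her announcement `(m j).y`. -/
noncomputable def tax (m : Profile N T L) (i : Fin N) : ℝ :=
  (∑ t, (C.p t + C.radialPrice (sOthers m i) (zeta m i) t) * (m i).y t
      + ∑ l, qOthers m i l * ∑ t, C.A l (i, t) * (m i).y t)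
    + ∑ t, ((m i).β t - (m (finRotate N i)).y t) ^ 2
    + ∑ l, (((m i).q l - qOthers m i l) ^ 2
        + (m i).q l * (C.b l - ∑ j ∈ Finset.univ.erase i, ∑ t, C.A l (j, t) * (m j).y t
            - ∑ t, C.A l (i, t) * proxy m i t))
    + ∑ t, (((m i).s t - sOthers m i t) ^ 2
        + (m i).s t * ((⨆ t', zeta m i t') - zeta m i t))

open Classical in
/-- The payoff of user `i`: utility of the allocated demand minus tax, and `-∞` if the utility is
`-∞`. -/
noncomputable def payoff (m : Profile N T L) (i : Fin N) : EReal :=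
  if ∀ t, (m i).y t ∈ C.dom i t then
    ((∑ t, C.v i t ((m i).y t) - C.tax m i : ℝ) : EReal)
  else ⊥

/-- (Pure) Nash equilibria of the game induced by the mechanism. -/
def IsNash (m : Profile N T L) : Prop :=
  (∀ i, (m i).Admissible) ∧
    ∀ i, ∀ m' : Msg T L, m'.Admissible → C.payoff (Function.update m i m') i ≤ C.payoff m i

/-! ### The learning algorithm -/

/-- User `i`'s demand at time `t` under the price vector `π`: the inverse of the marginal utility
at the aggregated price. -/
noncomputable def demandAt (π : Price T L) (i : Fin N) (t : Fin T) : ℝ :=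
  Function.invFunOn (deriv (C.v i t)) (C.dom i t)
    (C.p t + ∑ l, C.A l (i, t) * π (Sum.inl l) + π (Sum.inr t))

/-- The state in which the users suggest the given prices and announce the demand at them. -/
noncomputable def stateOf (π : Fin N → Price T L) : LearnState N T L :=
  ⟨π, fun i t => C.demandAt (π i) i t⟩

/-- User `i`'s price vector after the gradient step and before the projection. -/
noncomputable def tentativePrice (α : ℝ) (S : LearnState N T L) (i : Fin N) : Price T L :=
  WithLp.toLp 2 (Sum.elim
    (fun l => S.price i (Sum.inl l)
      - α * (C.b l - ∑ j, ∑ t, C.A l (j, t) * S.demand j t))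
    (fun t => S.price i (Sum.inr t) + α * ∑ j, S.demand j t))

/-- One iteration of the algorithm with price set `P` and step size `α`. -/
noncomputable def learnStep (P : Set (Price T L)) (α : ℝ) (S : LearnState N T L) :
    LearnState N T L :=
  C.stateOf fun i => euclideanProj P (C.tentativePrice α S i)

open Classical in
/-- The loop: at most the given number of iterations, stopped after an iteration that changes
nothing. -/
noncomputable def learnLoop (P : Set (Price T L)) (α : ℝ) :
    ℕ → LearnState N T L → LearnState N T L
  | 0, S => S
  | k + 1, S =>
    if C.learnStep P α S = S then C.learnStep P α S
    else learnLoop P α k (C.learnStep P α S)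

/-- The final state of the algorithm run for `K` iterations from the common initial prices `π₀`. -/
noncomputable def learnRun (P : Set (Price T L)) (α : ℝ) (π₀ : Price T L) (K : ℕ) :
    LearnState N T L :=
  C.learnLoop P α K (C.stateOf fun _ => π₀)

/-- The message profile `m(K)` returned by the algorithm. -/
noncomputable def learnProfile (P : Set (Price T L)) (α : ℝ) (π₀ : Price T L) (K : ℕ) :
    Profile N T L := fun i =>
  ((C.learnRun P α π₀ K).demand i,
    fun l => (C.learnRun P α π₀ K).price i (Sum.inl l),
    fun t => (C.learnRun P α π₀ K).price i (Sum.inr t),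
    (C.learnRun P α π₀ K).demand (finRotate N i))

end EnergyCommunity

/-!
For fixed demands the best peak variable is the largest load, so the welfare problem becomes the
maximization of a strongly concave function over `feasible`. Lagrange multipliers, obtained from
Farkas' lemma, turn its maximizer `x` into a Karush–Kuhn–Tucker pair, and by duality a price vector
is optimal exactly when it forms such a pair with `x`.

On price vectors whose peak prices sum to `p0`, the dual function has gradient `(b, 0) - Ã x(π)`,
where `x(π)` is the demand at the prices `π`, and the learning algorithm is the projected gradient
method for it. Strong concavity of the objective makes this gradient `δ' / ‖Ã‖ ^ 2`-cocoercive.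
Hence, for `α < 2 * δ' / ‖Ã‖ ^ 2`, an iteration is nonexpansive and its displacement is controlled
by the decrease of the distance to any fixed point; the fixed points are the optimal price vectors,
and Opial's argument gives convergence to one of them.

If all users announce a Karush–Kuhn–Tucker pair with correct proxies, then a deviation changes the
tax of the deviator to a linear payment at the announced prices plus squares plus the pairing of
the nonnegative deviating prices with the nonnegative slacks. Truthful prices make the extra terms
vanish, and stationarity says that the user's demand is optimal against the linear payment.
-/

open Filter Function Topology
open scoped RealInnerProductSpace NNReal

/-! ### Farkas' lemma and Lagrange multipliers -/

theorem mem_hull_image_of_forall_nonneg {𝕜 V ι : Type*} [Field 𝕜] [LinearOrder 𝕜]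
    [IsStrictOrderedRing 𝕜] [AddCommGroup V] [Module 𝕜 V] (s : Finset ι)
    (a : ι → Module.Dual 𝕜 V) (c : Module.Dual 𝕜 V)
    (h : ∀ d, (∀ i ∈ s, 0 ≤ a i d) → 0 ≤ c d) : c ∈ PointedCone.hull 𝕜 (a '' s) := by
  classical
  induction s using Finset.induction_on generalizing a c with
  | empty =>
    have hc : c = 0 := LinearMap.ext fun d =>
      le_antisymm (by simpa using h (-d) (by simp)) (h d (by simp))
    exact hc ▸ zero_mem _
  | insert j s _ ih =>
    by_cases hs : ∀ d, (∀ i ∈ s, 0 ≤ a i d) → 0 ≤ c d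
    · exact Submodule.span_mono (Set.image_mono (by simp)) (ih a c hs)
    -- Some `d` separates `c` from the cone of the first generators, so `a j d < 0`. Projecting
    -- along `d` onto the functionals that vanish at `d` reduces to the induction hypothesis.
    push Not at hs
    obtain ⟨d, hd, hcd⟩ := hs
    have hjd : a j d < 0 := by
      by_contra! hjd
      exact hcd.not_ge (h d ((Finset.forall_mem_insert _ _ _).2 ⟨hjd, hd⟩))
    have hproj := ih (fun i => a i - (a i d / a j d) • a j) (c - (c d / a j d) • a j)
      fun e he => by
        have key (g : Module.Dual 𝕜 V) :
            g (e - (a j e / a j d) • d) = (g - (g d / a j d) • a j) e := by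
          simp only [map_sub, map_smul, LinearMap.sub_apply, LinearMap.smul_apply, smul_eq_mul]
          ring
        rw [← key]
        refine h _ ((Finset.forall_mem_insert _ _ _).2 ⟨?_, fun i hi => ?_⟩)
        · simp [hjd.ne]
        · exact (key (a i)).symm ▸ he i hi
    have hmem {i} (hi : i ∈ insert j s) : a i ∈ PointedCone.hull 𝕜 (a '' ↑(insert j s)) :=
      Submodule.subset_span (Set.mem_image_of_mem a hi)
    have hj' := hmem (Finset.mem_insert_self j s)
    rw [← sub_add_cancel c ((c d / a j d) • a j)]
    refine add_mem (Submodule.span_le.2 ?_ hproj)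
      (PointedCone.smul_mem _ (div_nonneg_of_nonpos hcd.le hjd.le) hj')
    rintro _ ⟨i, hi, rfl⟩
    have hij : 0 ≤ -(a i d / a j d) :=
      neg_nonneg.2 (div_nonpos_of_nonneg_of_nonpos (hd i hi) hjd.le)
    simpa only [SetLike.mem_coe, neg_smul, ← sub_eq_add_neg] using
      add_mem (hmem (Finset.mem_insert_of_mem hi)) (PointedCone.smul_mem _ hij hj')

theorem mem_posTangentConeAt_of_active_nonpos {V ι : Type*} [NormedAddCommGroup V]
    [NormedSpace ℝ V] [Finite ι] {a : ι → V →L[ℝ] ℝ} {b : ι → ℝ} {x d : V}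
    (hx : ∀ j, a j x ≤ b j) (hd : ∀ j, a j x = b j → a j d ≤ 0) :
    d ∈ posTangentConeAt {z | ∀ j, a j z ≤ b j} x := by
  refine mem_posTangentConeAt_of_frequently_mem (Eventually.frequently ?_)
  refine eventually_all.2 fun j => ?_
  rcases (hx j).eq_or_lt with hj | hj
  · filter_upwards [self_mem_nhdsWithin] with ε hε
    have := mul_nonpos_of_nonneg_of_nonpos (Set.mem_Ioi.1 hε).le (hd j hj)
    simpa [hj] using this
  · have hcont : Tendsto (fun ε : ℝ => a j (x + ε • d)) (𝓝[>] 0) (𝓝 (a j (x + (0 : ℝ) • d))) :=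
      (Continuous.tendsto (by fun_prop) 0).mono_left nhdsWithin_le_nhds
    exact (hcont.eventually_lt_const (by simpa using hj)).mono fun _ => le_of_lt

theorem exists_lagrange_multipliers {V ι : Type*} [NormedAddCommGroup V] [NormedSpace ℝ V]
    [Fintype ι] {a : ι → V →L[ℝ] ℝ} {b : ι → ℝ} {f : V → ℝ} {f' : V →L[ℝ] ℝ} {x : V}
    (hf : HasFDerivAt f f' x) (hx : ∀ j, a j x ≤ b j)
    (hmax : IsLocalMaxOn f {z | ∀ j, a j z ≤ b j} x) :
    ∃ r : ι → ℝ, (∀ j, 0 ≤ r j) ∧ (∀ j, r j * (b j - a j x) = 0) ∧ f' = ∑ j, r j • a j := by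
  classical
  have hfarkas : (f' : V →ₗ[ℝ] ℝ) ∈ PointedCone.hull ℝ
      ((fun j => (a j : V →ₗ[ℝ] ℝ)) '' ↑({j | a j x = b j} : Finset ι)) := by
    refine mem_hull_image_of_forall_nonneg _ _ _ fun d hd => ?_
    have hcone : -d ∈ posTangentConeAt {z | ∀ j, a j z ≤ b j} x :=
      mem_posTangentConeAt_of_active_nonpos hx fun j hj => by
        simpa using hd j (by simpa using hj)
    simpa using hmax.hasFDerivWithinAt_nonpos hf.hasFDerivWithinAt hcone
  obtain ⟨r, hr⟩ := (Submodule.mem_span_image_finset_iff_exists_fun' _).1 hfarkas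
  refine ⟨fun j => if a j x = b j then (r j : ℝ) else 0, fun j => ?_, fun j => ?_, ?_⟩
  · dsimp only
    split_ifs
    exacts [(r j).2, le_rfl]
  · dsimp only
    split_ifs with hj <;> simp [hj]
  · ext d
    simp only [ite_smul, zero_smul, ← Finset.sum_filter, FunLike.coe_sum, Finset.sum_apply]
    exact (LinearMap.congr_fun hr d).symm.trans (LinearMap.sum_apply _ _ _)

/-! ### Strongly concave functions -/

theorem le_lineDeriv_of_strongConcaveOn {E : Type*} [NormedAddCommGroup E] [NormedSpace ℝ E]
    {s : Set E} {m : ℝ} {f : E → ℝ} (hf : StrongConcaveOn s m f) {x y : E} (hx : x ∈ s)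
    (hy : y ∈ s) {g : ℝ} (hg : HasLineDerivAt ℝ f g x (y - x)) :
    f y ≤ f x + g - m / 2 * ‖x - y‖ ^ 2 := by
  have hlow : Tendsto (fun ε : ℝ => f y - f x + (1 - ε) * (m / 2 * ‖x - y‖ ^ 2)) (𝓝[>] 0)
      (𝓝 (f y - f x + (1 - 0) * (m / 2 * ‖x - y‖ ^ 2))) :=
    (Continuous.tendsto (by fun_prop) 0).mono_left nhdsWithin_le_nhds
  have hle : f y - f x + (1 - 0) * (m / 2 * ‖x - y‖ ^ 2) ≤ g := by
    refine le_of_tendsto_of_tendsto hlow (hg.tendsto_slope_zero_right) ?_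
    filter_upwards [Ioo_mem_nhdsGT (zero_lt_one : (0 : ℝ) < 1)] with ε ⟨hε₀, hε₁⟩
    have hchord := hf.2 hx hy (sub_nonneg.2 hε₁.le) hε₀.le (by ring)
    have hpoint : (1 - ε) • x + ε • y = x + ε • (y - x) := by module
    rw [hpoint] at hchord
    simp only [smul_eq_mul] at hchord ⊢
    rw [inv_mul_eq_div, le_div_iff₀ hε₀]
    linarith
  linarith

section Gradient

variable {E : Type*} [NormedAddCommGroup E] [InnerProductSpace ℝ E] [CompleteSpace E]
  {s : Set E} {m : ℝ} {f : E → ℝ} {x y gx gy : E}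

theorem le_gradient_of_strongConcaveOn (hf : StrongConcaveOn s m f) (hx : x ∈ s) (hy : y ∈ s)
    (hg : HasGradientAt f gx x) : f y ≤ f x + ⟪gx, y - x⟫ - m / 2 * ‖x - y‖ ^ 2 :=
  le_lineDeriv_of_strongConcaveOn hf hx hy
    (by simpa using hg.hasFDerivAt.hasLineDerivAt (y - x))

theorem inner_gradient_sub_le_of_strongConcaveOn (hf : StrongConcaveOn s m f) (hx : x ∈ s)
    (hy : y ∈ s) (hgx : HasGradientAt f gx x) (hgy : HasGradientAt f gy y) :
    ⟪gx - gy, x - y⟫ ≤ -(m * ‖x - y‖ ^ 2) := by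
  have hxy := le_gradient_of_strongConcaveOn hf hx hy hgx
  have hyx := le_gradient_of_strongConcaveOn hf hy hx hgy
  rw [← neg_sub x y, inner_neg_right] at hxy
  rw [norm_sub_rev] at hyx
  rw [inner_sub_left]
  linarith

end Gradient

/-! ### Projections and cocoercive operators -/

section Projection

variable {E : Type*} [NormedAddCommGroup E] [InnerProductSpace ℝ E] {S : Set E}

theorem forall_dist_le_iff_inner_nonpos (hcv : Convex ℝ S) {x z : E} (hz : z ∈ S) :
    (∀ z' ∈ S, dist x z ≤ dist x z') ↔ ∀ z' ∈ S, ⟪x - z, z' - z⟫ ≤ 0 := by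
  have : Nonempty S := ⟨z, hz⟩
  have hbdd : BddBelow (Set.range fun w : S => ‖x - w‖) := ⟨0, by rintro _ ⟨w, rfl⟩; positivity⟩
  simp only [← norm_eq_iInf_iff_real_inner_le_zero hcv hz, dist_eq_norm]
  constructor
  · exact fun h => le_antisymm (le_ciInf fun w => h w w.2) (ciInf_le hbdd ⟨z, hz⟩)
  · exact fun h z' hz' => h.trans_le (ciInf_le hbdd ⟨z', hz'⟩)

theorem euclideanProj_spec (hne : S.Nonempty) (hS : IsComplete S) (hcv : Convex ℝ S) (x : E) :
    euclideanProj S x ∈ S ∧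
      ∀ z ∈ S, ⟪x - euclideanProj S x, z - euclideanProj S x⟫ ≤ 0 := by
  obtain ⟨z, hz, hmin⟩ := exists_norm_eq_iInf_of_complete_convex hne hS hcv x
  rw [norm_eq_iInf_iff_real_inner_le_zero hcv hz] at hmin
  obtain ⟨hmem, hdist⟩ : euclideanProj S x ∈ S ∧ ∀ z' ∈ S, dist x (euclideanProj S x) ≤ dist x z' :=
    Classical.epsilon_spec (p := fun z => z ∈ S ∧ ∀ z' ∈ S, dist x z ≤ dist x z')
      ⟨z, hz, (forall_dist_le_iff_inner_nonpos hcv hz).2 hmin⟩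
  exact ⟨hmem, (forall_dist_le_iff_inner_nonpos hcv hmem).1 hdist⟩

theorem euclideanProj_eq_iff (hS : IsComplete S) (hcv : Convex ℝ S) {x z : E} (hz : z ∈ S) :
    euclideanProj S x = z ↔ ∀ z' ∈ S, ⟪x - z, z' - z⟫ ≤ 0 := by
  obtain ⟨hmem, hproj⟩ := euclideanProj_spec ⟨z, hz⟩ hS hcv x
  refine ⟨fun h => by rwa [h] at hproj, fun h => ?_⟩
  have hxz := hproj z hz
  have hzx := h _ hmem
  set w := euclideanProj S x
  have hsum : ⟪x - w, z - w⟫ + ⟪x - z, w - z⟫ = ‖w - z‖ ^ 2 := by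
    rw [← real_inner_self_eq_norm_sq]
    simp only [inner_sub_left, inner_sub_right, real_inner_comm]
    ring
  exact sub_eq_zero.1 (norm_eq_zero.1 (pow_eq_zero_iff two_ne_zero |>.1
    (le_antisymm (by linarith) (sq_nonneg _))))

theorem norm_sq_euclideanProj_sub_add_le (hne : S.Nonempty) (hS : IsComplete S)
    (hcv : Convex ℝ S) (x y : E) :
    ‖euclideanProj S x - euclideanProj S y‖ ^ 2
        + ‖(x - euclideanProj S x) - (y - euclideanProj S y)‖ ^ 2 ≤ ‖x - y‖ ^ 2 := by
  obtain ⟨hx, hxproj⟩ := euclideanProj_spec hne hS hcv x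
  obtain ⟨hy, hyproj⟩ := euclideanProj_spec hne hS hcv y
  have hxy := hxproj _ hy
  have hyx := hyproj _ hx
  set u := euclideanProj S x
  set v := euclideanProj S y
  have hsplit : ‖x - y‖ ^ 2 = ‖u - v‖ ^ 2 + ‖(x - u) - (y - v)‖ ^ 2
      - 2 * (⟪x - u, v - u⟫ + ⟪y - v, u - v⟫) := by
    have h₁ : x - y = (u - v) + ((x - u) - (y - v)) := by abel
    rw [h₁, norm_add_sq_real, inner_sub_right, real_inner_comm, real_inner_comm (y - v),
      ← neg_sub u v, inner_neg_right]
    ring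
  linarith

end Projection

section Orbits

variable {X : Type*} {P : Set X} {Φ : X → X} {w x₀ : X}

theorem antitone_dist_iterate [PseudoMetricSpace X] (hmaps : Set.MapsTo Φ P P)
    (hlip : LipschitzOnWith 1 Φ P) (hw : w ∈ P) (hfix : Φ w = w) (hx₀ : x₀ ∈ P) :
    Antitone fun k => dist (Φ^[k] x₀) w := by
  refine antitone_nat_of_succ_le fun k => ?_
  have h := hlip.dist_le_mul _ (hmaps.iterate k hx₀) _ hw
  rwa [hfix, NNReal.coe_one, one_mul, ← iterate_succ_apply' Φ] at h

theorem tendsto_dist_iterate_succ [PseudoMetricSpace X] {C : ℝ}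
    (hanti : Antitone fun k => dist (Φ^[k] x₀) w)
    (hdist : ∀ k, dist (Φ^[k] x₀) (Φ (Φ^[k] x₀)) ^ 2
      ≤ C * (dist (Φ^[k] x₀) w ^ 2 - dist (Φ (Φ^[k] x₀)) w ^ 2)) :
    Tendsto (fun k => dist (Φ^[k] x₀) (Φ (Φ^[k] x₀))) atTop (𝓝 0) := by
  have hlim := tendsto_atTop_ciInf hanti ⟨0, by rintro _ ⟨k, rfl⟩; exact dist_nonneg⟩
  have hdecr := ((hlim.pow 2).sub ((hlim.comp (tendsto_add_atTop_nat 1)).pow 2)).const_mul C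
  rw [sub_self, mul_zero] at hdecr
  simp only [← iterate_succ_apply' Φ] at hdist ⊢
  have hsq := squeeze_zero (fun k => sq_nonneg _) hdist hdecr
  simpa only [Real.sqrt_sq dist_nonneg, Real.sqrt_zero] using hsq.sqrt

/-- Opial's argument: a nonexpansive map whose displacement is controlled by the decrease of the
distance to one fixed point has convergent orbits. -/
theorem exists_tendsto_iterate_of_dist_sq_le [MetricSpace X] [ProperSpace X] {C : ℝ}
    (hP : IsClosed P) (hmaps : Set.MapsTo Φ P P) (hlip : LipschitzOnWith 1 Φ P) (hw : w ∈ P)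
    (hfix : Φ w = w)
    (hdist : ∀ x ∈ P, dist x (Φ x) ^ 2 ≤ C * (dist x w ^ 2 - dist (Φ x) w ^ 2)) (hx₀ : x₀ ∈ P) :
    ∃ a ∈ P, Φ a = a ∧ Tendsto (fun k => Φ^[k] x₀) atTop (𝓝 a) := by
  have horbit (k : ℕ) : Φ^[k] x₀ ∈ P := hmaps.iterate k hx₀
  have hanti := antitone_dist_iterate hmaps hlip hw hfix hx₀
  have hball (k : ℕ) : Φ^[k] x₀ ∈ Metric.closedBall w (dist x₀ w) := hanti (Nat.zero_le k)
  obtain ⟨a, -, φ, hφ, hsub⟩ := tendsto_subseq_of_bounded Metric.isBounded_closedBall hball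
  have ha : a ∈ P := hP.mem_of_tendsto hsub (Eventually.of_forall fun k => horbit _)
  have hΦ : Tendsto (fun k => Φ (Φ^[φ k] x₀)) atTop (𝓝 (Φ a)) :=
    (hlip.continuousOn a ha).tendsto.comp
      (tendsto_nhdsWithin_iff.2 ⟨hsub, Eventually.of_forall fun k => horbit _⟩)
  have hfixa : Φ a = a := by
    have hzero := (tendsto_dist_iterate_succ hanti fun k => hdist _ (horbit k)).comp
      hφ.tendsto_atTop
    exact (dist_eq_zero.1 (tendsto_nhds_unique (hsub.dist hΦ) hzero)).symm
  exact ⟨a, ha, hfixa, tendsto_iff_dist_tendsto_zero.2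
    ((tendsto_iff_tendsto_subseq_of_antitone (antitone_dist_iterate hmaps hlip ha hfixa hx₀)
      hφ.tendsto_atTop).2 (tendsto_iff_dist_tendsto_zero.1 hsub))⟩

end Orbits

section Cocoercive

variable {E : Type*} [NormedAddCommGroup E] [InnerProductSpace ℝ E] {P : Set E} {T : E → E}
  {α β : ℝ}

/-- `T` is `β`-cocoercive (inverse strongly monotone) on `P`: the regularity of a map that makes
its projected gradient iteration converge for step sizes below `2 * β`. -/
def CocoerciveOn (P : Set E) (β : ℝ) (T : E → E) : Prop :=
  ∀ ⦃x⦄, x ∈ P → ∀ ⦃y⦄, y ∈ P → β * ‖T x - T y‖ ^ 2 ≤ ⟪T x - T y, x - y⟫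

/-- One step of the projected gradient method for the variational inequality of `T` on `P`, with
step size `α`. -/
noncomputable def projStep (P : Set E) (α : ℝ) (T : E → E) (x : E) : E :=
  euclideanProj P (x - α • T x)

theorem projStep_eq_self_iff (hP : IsComplete P) (hcv : Convex ℝ P) (hα : 0 < α) {x : E}
    (hx : x ∈ P) : projStep P α T x = x ↔ ∀ z ∈ P, 0 ≤ ⟪T x, z - x⟫ := by
  rw [projStep, euclideanProj_eq_iff hP hcv hx]
  refine forall₂_congr fun z _ => ?_
  rw [sub_sub_cancel_left, inner_neg_left, real_inner_smul_left, neg_nonpos,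
    mul_nonneg_iff_of_pos_left hα]

theorem CocoerciveOn.norm_sq_projStep_sub_add_le (hT : CocoerciveOn P β T) (hP : IsComplete P)
    (hcv : Convex ℝ P) (hα : 0 ≤ α) {x y : E} (hx : x ∈ P) (hy : y ∈ P) :
    ‖projStep P α T x - projStep P α T y‖ ^ 2 + α * (2 * β - α) * ‖T x - T y‖ ^ 2
        + ‖(x - α • T x - projStep P α T x) - (y - α • T y - projStep P α T y)‖ ^ 2
      ≤ ‖x - y‖ ^ 2 := by
  have hproj := norm_sq_euclideanProj_sub_add_le ⟨x, hx⟩ hP hcv (x - α • T x) (y - α • T y)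
  have hstep : ‖(x - α • T x) - (y - α • T y)‖ ^ 2
      = ‖x - y‖ ^ 2 - 2 * α * ⟪T x - T y, x - y⟫ + α ^ 2 * ‖T x - T y‖ ^ 2 := by
    have h₁ : (x - α • T x) - (y - α • T y) = (x - y) - α • (T x - T y) := by module
    rw [h₁, norm_sub_sq_real, real_inner_smul_right, real_inner_comm, norm_smul, mul_pow,
      Real.norm_eq_abs, sq_abs]
    ring
  have hcoc := mul_le_mul_of_nonneg_left (hT hx hy) (mul_nonneg zero_le_two hα)
  simp only [projStep]
  linarith

theorem CocoerciveOn.lipschitzOnWith_projStep (hT : CocoerciveOn P β T) (hP : IsComplete P)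
    (hcv : Convex ℝ P) (hα : 0 ≤ α) (hαβ : α ≤ 2 * β) :
    LipschitzOnWith 1 (projStep P α T) P := by
  refine LipschitzOnWith.of_dist_le_mul fun x hx y hy => ?_
  have h := hT.norm_sq_projStep_sub_add_le hP hcv hα hx hy
  have := mul_nonneg (mul_nonneg hα (sub_nonneg.2 hαβ)) (sq_nonneg ‖T x - T y‖)
  rw [NNReal.coe_one, one_mul, dist_eq_norm, dist_eq_norm]
  refine le_of_sq_le_sq ?_ (norm_nonneg _)
  linarith [sq_nonneg ‖(x - α • T x - projStep P α T x) - (y - α • T y - projStep P α T y)‖]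

theorem CocoerciveOn.dist_projStep_sq_le (hT : CocoerciveOn P β T) (hP : IsComplete P)
    (hcv : Convex ℝ P) (hα : 0 ≤ α) (hαβ : α < 2 * β) {x w : E} (hx : x ∈ P) (hw : w ∈ P)
    (hfix : projStep P α T w = w) :
    dist x (projStep P α T x) ^ 2
      ≤ (2 * α / (2 * β - α) + 2) * (dist x w ^ 2 - dist (projStep P α T x) w ^ 2) := by
  have h := hT.norm_sq_projStep_sub_add_le hP hcv hα hx hw
  rw [hfix] at h
  simp only [dist_eq_norm]
  set u := projStep P α T x
  set e := (x - α • T x - u) - (w - α • T w - w)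
  have hpos : 0 < 2 * β - α := sub_pos.2 hαβ
  have hdecomp : x - u = α • (T x - T w) + e := by simp only [e]; module
  have hpar : ‖x - u‖ ^ 2 ≤ 2 * (α ^ 2 * ‖T x - T w‖ ^ 2) + 2 * ‖e‖ ^ 2 := by
    have := parallelogram_law_with_norm ℝ (α • (T x - T w)) e
    rw [← hdecomp, norm_smul, Real.norm_eq_abs] at this
    nlinarith [sq_abs α, sq_nonneg ‖α • (T x - T w) - e‖]
  have hgrad : 2 * (α ^ 2 * ‖T x - T w‖ ^ 2)
      = 2 * α / (2 * β - α) * (α * (2 * β - α) * ‖T x - T w‖ ^ 2) := by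
    field_simp
  have hcoef : 0 ≤ 2 * α / (2 * β - α) := by positivity
  have hsq : 0 ≤ α * (2 * β - α) * ‖T x - T w‖ ^ 2 := by positivity
  nlinarith [sq_nonneg ‖e‖]

theorem mapsTo_projStep (hP : IsComplete P) (hcv : Convex ℝ P) :
    Set.MapsTo (projStep P α T) P P :=
  fun _ hx => (euclideanProj_spec ⟨_, hx⟩ hP hcv _).1

theorem CocoerciveOn.antitone_dist_iterate_projStep (hT : CocoerciveOn P β T)
    (hP : IsComplete P) (hcv : Convex ℝ P) (hα : 0 ≤ α) (hαβ : α ≤ 2 * β) {w x₀ : E}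
    (hw : w ∈ P) (hfix : projStep P α T w = w) (hx₀ : x₀ ∈ P) :
    Antitone fun k => dist ((projStep P α T)^[k] x₀) w :=
  antitone_dist_iterate (mapsTo_projStep hP hcv) (hT.lipschitzOnWith_projStep hP hcv hα hαβ) hw
    hfix hx₀

theorem CocoerciveOn.exists_tendsto_iterate_projStep [ProperSpace E] (hT : CocoerciveOn P β T)
    (hP : IsClosed P) (hcv : Convex ℝ P) (hα : 0 ≤ α) (hαβ : α < 2 * β) {w x₀ : E} (hw : w ∈ P)
    (hfix : projStep P α T w = w) (hx₀ : x₀ ∈ P) :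
    ∃ a ∈ P, projStep P α T a = a ∧ Tendsto (fun k => (projStep P α T)^[k] x₀) atTop (𝓝 a) :=
  exists_tendsto_iterate_of_dist_sq_le hP (mapsTo_projStep hP.isComplete hcv)
    (hT.lipschitzOnWith_projStep hP.isComplete hcv hα hαβ.le) hw hfix
    (fun _ hx => hT.dist_projStep_sq_le hP.isComplete hcv hα hαβ hx hw hfix) hx₀

end Cocoercive

namespace EnergyCommunity

open scoped InnerProduct

variable {N T L : ℕ} {C : EnergyCommunity N T L} {δ : ℝ} {rlo rhi : Fin N → Fin T → ℝ}

/-! ### The welfare problem -/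

/-- The single utilities are differentiable on their effective domains, which are open: the
regularity that makes `objective` differentiable and gives demands as solutions of first-order
conditions. -/
structure DifferentiableUtilities (C : EnergyCommunity N T L) : Prop where
  isOpen_dom : ∀ i t, IsOpen (C.dom i t)
  differentiable : ∀ i t, DifferentiableOn ℝ (C.v i t) (C.dom i t)

/-- The matrix `Ã` as a continuous linear map between Euclidean spaces; its operator norm is
`normAtilde` by definition. -/
noncomputable def constraintCLM (C : EnergyCommunity N T L) : Alloc N T →L[ℝ] Price T L :=
  LinearMap.toContinuousLinearMap (Matrix.toEuclideanLin C.Atilde)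

/-- The right-hand side `(b, 0)` of the stacked constraints. -/
noncomputable def bound (C : EnergyCommunity N T L) : Price T L := WithLp.toLp 2 (Sum.elim C.b 0)

/-- The total demand in slot `t`. -/
def load (x : Alloc N T) (t : Fin T) : ℝ := ∑ i, x (i, t)

/-- The peak demand. -/
noncomputable def peak (x : Alloc N T) : ℝ := ⨆ t, load x t

/-- The value of the welfare problem at `x`, with the optimal choice `w = peak x` of the peak
variable. -/
noncomputable def welfare (C : EnergyCommunity N T L) (x : Alloc N T) : ℝ :=
  C.objective x - C.p0 * peak x

/-- The slacks of all constraints at `x` and `w = peak x`. -/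
noncomputable def slack (C : EnergyCommunity N T L) (x : Alloc N T) : Price T L :=
  WithLp.toLp 2 (Sum.elim (fun l => C.b l - (C.A *ᵥ x.ofLp) l) fun t => peak x - load x t)

/-- The gradient of `objective`: marginal utilities minus unit prices. -/
noncomputable def objectiveGrad (C : EnergyCommunity N T L) (x : Alloc N T) : Alloc N T :=
  WithLp.toLp 2 fun j => deriv (C.v j.1 j.2) (x j) - C.p j.2

theorem load_le_peak (x : Alloc N T) (t : Fin T) : load x t ≤ peak x :=
  le_ciSup (Set.finite_range _).bddAbove t

theorem continuous_peak (hT : 1 ≤ T) : Continuous (peak : Alloc N T → ℝ) := by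
  have : Nonempty (Fin T) := ⟨⟨0, hT⟩⟩
  have hsup (x : Alloc N T) : peak x = Finset.univ.sup' Finset.univ_nonempty (load x) :=
    (Finset.sup'_univ_eq_ciSup _).symm
  simp only [funext hsup]
  exact Continuous.finset_sup'_apply _ fun t _ => by unfold load; fun_prop

@[simp]
theorem constraintCLM_inl (C : EnergyCommunity N T L) (x : Alloc N T) (l : Fin L) :
    C.constraintCLM x (Sum.inl l) = (C.A *ᵥ x.ofLp) l := by
  simp [constraintCLM, Atilde, Matrix.toLpLin_apply, Matrix.fromRows_mulVec]

@[simp]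
theorem constraintCLM_inr (C : EnergyCommunity N T L) (x : Alloc N T) (t : Fin T) :
    C.constraintCLM x (Sum.inr t) = load x t := by
  simp [constraintCLM, Atilde, Matrix.toLpLin_apply, Matrix.fromRows_mulVec, Matrix.mulVec,
    dotProduct, load, Fintype.sum_prod_type]

theorem adjoint_constraintCLM_apply (C : EnergyCommunity N T L) (π : Price T L)
    (j : Fin N × Fin T) : ((C.constraintCLM†) π) j = (C.Atildeᵀ *ᵥ π.ofLp) j := by
  rw [constraintCLM, ← LinearMap.adjoint_toContinuousLinearMap,
    ← Matrix.toEuclideanLin_conjTranspose_eq_adjoint, Matrix.conjTranspose_eq_transpose_of_trivial]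
  rfl

theorem transpose_mulVec_apply (C : EnergyCommunity N T L) (π : Fin L ⊕ Fin T → ℝ) (i : Fin N)
    (t : Fin T) :
    (C.Atildeᵀ *ᵥ π) (i, t) = ∑ l, C.A l (i, t) * π (Sum.inl l) + π (Sum.inr t) := by
  simp [Atilde, Matrix.mulVec, dotProduct]

theorem inner_price (π ρ : Price T L) :
    ⟪π, ρ⟫ = ∑ l, π (Sum.inl l) * ρ (Sum.inl l) + ∑ t, π (Sum.inr t) * ρ (Sum.inr t) := by
  simp [PiLp.inner_apply, mul_comm]

theorem inner_slack (C : EnergyCommunity N T L) (π : Price T L) (x : Alloc N T) :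
    ⟪π, C.slack x⟫ = ⟪π, C.bound - C.constraintCLM x⟫ + (∑ t, π (Sum.inr t)) * peak x := by
  simp only [inner_price, slack, bound, PiLp.sub_apply, constraintCLM_inl, constraintCLM_inr,
    Sum.elim_inl, Sum.elim_inr, Pi.zero_apply, zero_sub, mul_neg, mul_sub, Finset.sum_sub_distrib,
    Finset.sum_neg_distrib, Finset.sum_mul]
  ring

theorem inner_slack_nonneg {π : Price T L} (hπ : ∀ j, 0 ≤ π j) {x : Alloc N T}
    (hx : x ∈ C.feasible) : 0 ≤ ⟪π, C.slack x⟫ := by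
  rw [inner_price]
  exact add_nonneg
    (Finset.sum_nonneg fun l _ => mul_nonneg (hπ _) (sub_nonneg.2 (hx l)))
    (Finset.sum_nonneg fun t _ => mul_nonneg (hπ _) (sub_nonneg.2 (load_le_peak x t)))

theorem lagrangian_eq (C : EnergyCommunity N T L) (π : Price T L) (x : Alloc N T) (w : ℝ) :
    C.lagrangian π x w = C.objective x + ⟪π, C.bound - C.constraintCLM x⟫
      + (∑ t, π (Sum.inr t) - C.p0) * w := by
  simp only [inner_price, lagrangian, bound, PiLp.sub_apply, constraintCLM_inl, constraintCLM_inr,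
    Sum.elim_inl, Sum.elim_inr, Pi.zero_apply, mul_sub, Finset.sum_sub_distrib, ← Finset.sum_mul,
    load]
  ring

theorem lagrangian_peak (C : EnergyCommunity N T L) (π : Price T L) (x : Alloc N T) :
    C.lagrangian π x (peak x) = C.welfare x + ⟪π, C.slack x⟫ := by
  rw [lagrangian_eq, inner_slack, welfare]
  ring

theorem isOpen_allocDom (hC : C.DifferentiableUtilities) : IsOpen C.allocDom := by
  simp only [allocDom, Set.ofPred_forall]
  exact isOpen_iInter_of_finite fun i => isOpen_iInter_of_finite fun t =>
    (hC.isOpen_dom i t).preimage (by fun_prop)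

theorem hasGradientAt_objective (hC : C.DifferentiableUtilities) {x : Alloc N T}
    (hx : x ∈ C.allocDom) : HasGradientAt C.objective (C.objectiveGrad x) x := by
  rw [hasGradientAt_iff_hasFDerivAt]
  have hterm (i : Fin N) (t : Fin T) :
      HasFDerivAt (fun z : Alloc N T => C.v i t (z (i, t)) - C.p t * z (i, t))
        (deriv (C.v i t) (x (i, t)) • EuclideanSpace.proj (i, t)
          - C.p t • (EuclideanSpace.proj (i, t) : Alloc N T →L[ℝ] ℝ)) x := by
    have hv : HasDerivAt (C.v i t) (deriv (C.v i t) (x (i, t))) (x (i, t)) :=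
      ((hC.differentiable i t).differentiableAt ((hC.isOpen_dom i t).mem_nhds (hx i t))).hasDerivAt
    have hproj := (EuclideanSpace.proj (i, t) : Alloc N T →L[ℝ] ℝ).hasFDerivAt (x := x)
    exact (hv.comp_hasFDerivAt x hproj).sub (hproj.const_mul (C.p t))
  refine (HasFDerivAt.fun_sum fun i _ => HasFDerivAt.fun_sum fun t _ => hterm i t).congr_fderiv ?_
  ext d
  simp [objectiveGrad, PiLp.inner_apply, Fintype.sum_prod_type, mul_sub, mul_comm]

theorem PriceBounds.feasible_subset (hr : C.PriceBounds rlo rhi) : C.feasible ⊆ C.allocDom :=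
  fun x hx i t => (hr.mem_Icc x hx i t).1

/-! ### Duality -/

/-- The Karush–Kuhn–Tucker conditions for prices `π` and demand `x`, with the peak variable
eliminated: complementary slackness of all constraints is a single orthogonality relation. -/
structure IsKKT (C : EnergyCommunity N T L) (π : Price T L) (x : Alloc N T) : Prop where
  mem_allocDom : x ∈ C.allocDom
  mem_feasible : x ∈ C.feasible
  nonneg : ∀ j, 0 ≤ π j
  sum_peak : ∑ t, π (Sum.inr t) = C.p0
  stationary : C.objectiveGrad x = (C.constraintCLM†) π
  complementary : ⟪π, C.slack x⟫ = 0

theorem welfare_le_dual {x : Alloc N T} (hdom : x ∈ C.allocDom) (hx : x ∈ C.feasible)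
    {π : Price T L} (hπ : ∀ j, 0 ≤ π j) : (C.welfare x : EReal) ≤ C.dual π := by
  have hlag : C.welfare x ≤ C.lagrangian π x (peak x) := by
    rw [lagrangian_peak]
    exact le_add_of_nonneg_right (inner_slack_nonneg hπ hx)
  exact (EReal.coe_le_coe_iff.2 hlag).trans
    (le_iSup₂_of_le x hdom (le_iSup (fun w => (C.lagrangian π x w : EReal)) _))

theorem dual_le_iff {π : Price T L} {r : ℝ} :
    C.dual π ≤ r ↔ ∀ z ∈ C.allocDom, ∀ w, C.lagrangian π z w ≤ r := by
  simp only [dual, iSup_le_iff, EReal.coe_le_coe_iff]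

theorem IsKKT.dual_le_welfare (hC : C.DifferentiableUtilities)
    (hf : ConcaveOn ℝ C.allocDom C.objective) {π : Price T L} {x : Alloc N T}
    (h : C.IsKKT π x) : C.dual π ≤ C.welfare x := by
  refine dual_le_iff.2 fun z hz w => ?_
  have htangent := le_gradient_of_strongConcaveOn (strongConcaveOn_zero.2 hf) h.mem_allocDom hz
    (hasGradientAt_objective hC h.mem_allocDom)
  rw [h.stationary, ContinuousLinearMap.adjoint_inner_left, map_sub, inner_sub_right] at htangent
  have hwelfare := C.lagrangian_peak π x
  rw [h.complementary, lagrangian_eq, inner_sub_right, h.sum_peak] at hwelfare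
  rw [lagrangian_eq, inner_sub_right, h.sum_peak]
  linarith

theorem IsKKT.isOptimalPrice (hC : C.DifferentiableUtilities)
    (hf : ConcaveOn ℝ C.allocDom C.objective) {π : Price T L} {x : Alloc N T}
    (h : C.IsKKT π x) : C.IsOptimalPrice π :=
  ⟨h.nonneg, fun _ hρ => (h.dual_le_welfare hC hf).trans
    (welfare_le_dual h.mem_allocDom h.mem_feasible hρ)⟩

theorem objectiveGrad_eq_of_isMaxOn (hC : C.DifferentiableUtilities) {π : Price T L}
    {x : Alloc N T} (hx : x ∈ C.allocDom)
    (hmax : IsMaxOn (fun z => C.objective z - ⟪π, C.constraintCLM z⟫) C.allocDom x) :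
    C.objectiveGrad x = (C.constraintCLM†) π := by
  have hlin : HasFDerivAt (fun z => ⟪π, C.constraintCLM z⟫)
      (innerSL ℝ ((C.constraintCLM†) π)) x :=
    (innerSL ℝ ((C.constraintCLM†) π)).hasFDerivAt.congr_of_eventuallyEq
      (Eventually.of_forall fun z => (C.constraintCLM.adjoint_inner_left z π).symm)
  have hzero := (hmax.isLocalMax ((isOpen_allocDom hC).mem_nhds hx)).hasFDerivAt_eq_zero
    ((hasGradientAt_objective hC hx).hasFDerivAt.sub hlin)
  refine ext_inner_right ℝ fun d => sub_eq_zero.1 ?_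
  simpa using DFunLike.congr_fun hzero d

theorem isKKT_of_dual_le_welfare (hC : C.DifferentiableUtilities) {π : Price T L}
    {x : Alloc N T} (hdom : x ∈ C.allocDom) (hx : x ∈ C.feasible) (hπ : ∀ j, 0 ≤ π j)
    (h : C.dual π ≤ C.welfare x) : C.IsKKT π x := by
  have hlag := dual_le_iff.1 h
  have hcompl : ⟪π, C.slack x⟫ = 0 := by
    have := hlag x hdom (peak x)
    rw [lagrangian_peak] at this
    exact le_antisymm (by linarith) (inner_slack_nonneg hπ hx)
  have hwelfare := C.lagrangian_peak π x
  rw [hcompl, add_zero, lagrangian_eq] at hwelfare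
  have hsum : ∑ t, π (Sum.inr t) = C.p0 := by
    have hup := hlag x hdom (peak x + 1)
    have hdown := hlag x hdom (peak x - 1)
    rw [lagrangian_eq] at hup hdown
    linarith
  refine ⟨hdom, hx, hπ, hsum, objectiveGrad_eq_of_isMaxOn hC hdom fun z hz => ?_, hcompl⟩
  have hz' := hlag z hz 0
  rw [hsum, inner_sub_right] at hwelfare
  rw [lagrangian_eq, inner_sub_right] at hz'
  change C.objective z - ⟪π, C.constraintCLM z⟫ ≤ C.objective x - ⟪π, C.constraintCLM x⟫
  linarith

theorem IsKKT.isOptimalPrice_iff (hC : C.DifferentiableUtilities)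
    (hf : ConcaveOn ℝ C.allocDom C.objective) {π ρ : Price T L} {x : Alloc N T}
    (h : C.IsKKT π x) : C.IsOptimalPrice ρ ↔ C.IsKKT ρ x :=
  ⟨fun hρ => isKKT_of_dual_le_welfare hC h.mem_allocDom h.mem_feasible hρ.1
    ((hρ.2 π h.nonneg).trans (h.dual_le_welfare hC hf)), fun hρ => hρ.isOptimalPrice hC hf⟩

/-! ### Existence of multipliers -/

theorem isClosed_feasible (C : EnergyCommunity N T L) : IsClosed C.feasible := by
  simp only [feasible, ← constraintCLM_inl, Set.ofPred_forall]
  exact isClosed_iInter fun l => isClosed_le (by fun_prop) continuous_const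

theorem mul_norm_sub_le_norm_objectiveGrad_sub (hC : C.DifferentiableUtilities)
    (hf : StrongConcaveOn C.allocDom δ C.objective) {x z : Alloc N T} (hx : x ∈ C.allocDom)
    (hz : z ∈ C.allocDom) : δ * ‖x - z‖ ≤ ‖C.objectiveGrad x - C.objectiveGrad z‖ := by
  have hmono := inner_gradient_sub_le_of_strongConcaveOn hf hx hz (hasGradientAt_objective hC hx)
    (hasGradientAt_objective hC hz)
  have hcs := neg_le_of_abs_le (abs_real_inner_le_norm
    (C.objectiveGrad x - C.objectiveGrad z) (x - z))
  rcases (norm_nonneg (x - z)).eq_or_lt with h | h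
  · rw [← h, mul_zero]
    exact norm_nonneg _
  · exact le_of_mul_le_mul_right (by linarith) h

theorem norm_objectiveGrad_sub_le (hr : C.PriceBounds rlo rhi) {x z : Alloc N T}
    (hx : x ∈ C.feasible) (hz : z ∈ C.feasible) :
    ‖C.objectiveGrad x - C.objectiveGrad z‖
      ≤ ‖(WithLp.toLp 2 fun j => rhi j.1 j.2 - rlo j.1 j.2 : Alloc N T)‖ := by
  rw [EuclideanSpace.norm_eq, EuclideanSpace.norm_eq]
  refine Real.sqrt_le_sqrt (Finset.sum_le_sum fun j _ => pow_le_pow_left₀ (norm_nonneg _) ?_ 2)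
  have hxj := (hr.mem_Icc x hx j.1 j.2).2
  have hzj := (hr.mem_Icc z hz j.1 j.2).2
  refine (?_ : ‖_‖ ≤ _).trans (le_abs_self _)
  rw [Real.norm_eq_abs, PiLp.sub_apply, objectiveGrad, objectiveGrad, sub_sub_sub_cancel_right]
  exact abs_sub_le_of_le_of_le hxj.1 hxj.2 hzj.1 hzj.2

theorem isBounded_feasible (hC : C.DifferentiableUtilities) (hr : C.PriceBounds rlo rhi)
    (hδ : 0 < δ) (hf : StrongConcaveOn C.allocDom δ C.objective) :
    Bornology.IsBounded C.feasible := by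
  refine Metric.isBounded_iff.2
    ⟨‖(WithLp.toLp 2 fun j => rhi j.1 j.2 - rlo j.1 j.2 : Alloc N T)‖ / δ, fun x hx z hz => ?_⟩
  rw [dist_eq_norm, le_div_iff₀' hδ]
  exact (mul_norm_sub_le_norm_objectiveGrad_sub hC hf (hr.feasible_subset hx)
    (hr.feasible_subset hz)).trans (norm_objectiveGrad_sub_le hr hx hz)

theorem exists_isMaxOn_welfare (hT : 1 ≤ T) (hC : C.DifferentiableUtilities)
    (hr : C.PriceBounds rlo rhi) (hne : C.feasible.Nonempty) (hδ : 0 < δ)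
    (hf : StrongConcaveOn C.allocDom δ C.objective) :
    ∃ x ∈ C.feasible, IsMaxOn C.welfare C.feasible x := by
  have hcompact : IsCompact C.feasible :=
    Metric.isCompact_of_isClosed_isBounded C.isClosed_feasible (isBounded_feasible hC hr hδ hf)
  refine hcompact.exists_isMaxOn hne (ContinuousOn.sub (fun x hx => ?_)
    (continuous_const.mul (continuous_peak hT)).continuousOn)
  exact (hasGradientAt_objective hC (hr.feasible_subset hx)).continuousAt.continuousWithinAt

/-- The constraints of the welfare problem as functionals of `(x, w)`: the map sends `j` to the
`j`-th row of `Ã x`, minus `w` for the peak constraints. -/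
noncomputable def peakConstraint (C : EnergyCommunity N T L) (j : Fin L ⊕ Fin T) :
    Alloc N T × ℝ →L[ℝ] ℝ :=
  (EuclideanSpace.proj j ∘L C.constraintCLM) ∘L ContinuousLinearMap.fst ℝ _ _
    - (Sum.elim 0 1 j : ℝ) • ContinuousLinearMap.snd ℝ _ _

@[simp]
theorem peakConstraint_apply (C : EnergyCommunity N T L) (j : Fin L ⊕ Fin T) (x : Alloc N T)
    (w : ℝ) : C.peakConstraint j (x, w) = C.constraintCLM x j - (Sum.elim 0 1 j : ℝ) * w := rfl

theorem bound_sub_peakConstraint (C : EnergyCommunity N T L) (x : Alloc N T)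
    (j : Fin L ⊕ Fin T) : C.bound j - C.peakConstraint j (x, peak x) = C.slack x j := by
  cases j <;> simp [bound, slack]

theorem exists_isKKT_of_isMaxOn (hT : 1 ≤ T) (hC : C.DifferentiableUtilities) (hp0 : 0 ≤ C.p0)
    {x : Alloc N T} (hdom : x ∈ C.allocDom) (hx : x ∈ C.feasible)
    (hmax : IsMaxOn C.welfare C.feasible x) : ∃ π, C.IsKKT π x := by
  have hderiv : HasFDerivAt (fun z : Alloc N T × ℝ => C.objective z.1 - C.p0 * z.2)
      (innerSL ℝ (C.objectiveGrad x) ∘L ContinuousLinearMap.fst ℝ _ _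
        - C.p0 • ContinuousLinearMap.snd ℝ _ _) (x, peak x) :=
    (HasFDerivAt.comp (g := C.objective) (x, peak x)
      (hasGradientAt_objective hC hdom).hasFDerivAt hasFDerivAt_fst).fun_sub
      (HasFDerivAt.const_mul (hasFDerivAt_snd (p := (x, peak x))) C.p0)
  have hmax' : IsMaxOn (fun z : Alloc N T × ℝ => C.objective z.1 - C.p0 * z.2)
      {z | ∀ j, C.peakConstraint j z ≤ C.bound j} (x, peak x) := by
    rintro ⟨z, w⟩ hz
    have : Nonempty (Fin T) := ⟨⟨0, hT⟩⟩
    have hzfeas : z ∈ C.feasible := fun l => by simpa [bound] using hz (Sum.inl l)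
    have hpeak : peak z ≤ w := ciSup_le fun t => by simpa [bound] using hz (Sum.inr t)
    exact (sub_le_sub_left (mul_le_mul_of_nonneg_left hpeak hp0) _).trans (hmax hzfeas)
  obtain ⟨r, hr, hcompl, hgrad⟩ := exists_lagrange_multipliers hderiv (fun j => by
    rw [← sub_nonneg, bound_sub_peakConstraint]
    cases j
    exacts [sub_nonneg.2 (hx _), sub_nonneg.2 (load_le_peak x _)]) hmax'.localize
  refine ⟨WithLp.toLp 2 r, hdom, hx, hr, ?_, ext_inner_right ℝ fun d => ?_, ?_⟩
  · simpa [eq_comm] using DFunLike.congr_fun hgrad ((0 : Alloc N T), (1 : ℝ))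
  · rw [ContinuousLinearMap.adjoint_inner_left]
    simpa [PiLp.inner_apply, mul_comm] using DFunLike.congr_fun hgrad (d, (0 : ℝ))
  · simp only [bound_sub_peakConstraint] at hcompl
    rw [real_inner_comm, PiLp.inner_apply]
    exact Finset.sum_eq_zero fun j _ => hcompl j

theorem exists_isKKT (hT : 1 ≤ T) (hC : C.DifferentiableUtilities) (hr : C.PriceBounds rlo rhi)
    (hne : C.feasible.Nonempty) (hδ : 0 < δ) (hf : StrongConcaveOn C.allocDom δ C.objective)
    (hp0 : 0 ≤ C.p0) : ∃ π x, C.IsKKT π x := by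
  obtain ⟨x, hx, hmax⟩ := exists_isMaxOn_welfare hT hC hr hne hδ hf
  obtain ⟨π, hπ⟩ := exists_isKKT_of_isMaxOn hT hC hp0 (hr.feasible_subset hx) hx hmax
  exact ⟨π, x, hπ⟩

/-! ### The dual gradient -/

/-- The vector of all users' demands at the price vector `π`. -/
noncomputable def demandVec (C : EnergyCommunity N T L) (π : Price T L) : Alloc N T :=
  WithLp.toLp 2 fun j => C.demandAt π j.1 j.2

/-- The gradient of the dual function, restricted to price vectors whose peak prices sum to `p0`:
the slacks `(b, 0) - Ã x` of the stacked constraints at the demand. -/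
noncomputable def dualGrad (C : EnergyCommunity N T L) (π : Price T L) : Price T L :=
  C.bound - C.constraintCLM (C.demandVec π)

theorem dualGrad_sub (C : EnergyCommunity N T L) (π ρ : Price T L) :
    C.dualGrad π - C.dualGrad ρ = -C.constraintCLM (C.demandVec π - C.demandVec ρ) := by
  rw [dualGrad, dualGrad, map_sub]
  abel

theorem demandVec_spec (hr : C.PriceBounds rlo rhi) {π : Price T L}
    (hπ : π ∈ C.properPrices rlo rhi) :
    C.demandVec π ∈ C.allocDom ∧ C.objectiveGrad (C.demandVec π) = (C.constraintCLM†) π := by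
  have hprice (i : Fin N) (t : Fin T) : (C.Atildeᵀ *ᵥ π.ofLp) (i, t) + C.p t
      = C.p t + ∑ l, C.A l (i, t) * π (Sum.inl l) + π (Sum.inr t) := by
    rw [transpose_mulVec_apply, add_comm, ← add_assoc]
  have hex (i : Fin N) (t : Fin T) : ∃ z ∈ C.dom i t, deriv (C.v i t) z
      = C.p t + ∑ l, C.A l (i, t) * π (Sum.inl l) + π (Sum.inr t) :=
    hprice i t ▸ hr.exists_eq i t _ (hπ.2.1 i t)
  refine ⟨fun i t => invFunOn_mem (hex i t), ?_⟩
  ext ⟨i, t⟩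
  rw [adjoint_constraintCLM_apply]
  exact sub_eq_iff_eq_add.2 ((invFunOn_eq (hex i t)).trans (hprice i t).symm)

theorem demandVec_eq (hC : C.DifferentiableUtilities) (hr : C.PriceBounds rlo rhi) (hδ : 0 < δ)
    (hf : StrongConcaveOn C.allocDom δ C.objective) {π : Price T L}
    (hπ : π ∈ C.properPrices rlo rhi) {x : Alloc N T} (hx : x ∈ C.allocDom)
    (hgrad : C.objectiveGrad x = (C.constraintCLM†) π) : C.demandVec π = x := by
  obtain ⟨hdom, hgrad'⟩ := demandVec_spec hr hπ
  have h := mul_norm_sub_le_norm_objectiveGrad_sub hC hf hdom hx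
  rw [hgrad', hgrad, sub_self, norm_zero] at h
  exact sub_eq_zero.1 (norm_le_zero_iff.1 (nonpos_of_mul_nonpos_right h hδ))

theorem IsKKT.mem_properPrices (hr : C.PriceBounds rlo rhi) {π : Price T L} {x : Alloc N T}
    (h : C.IsKKT π x) : π ∈ C.properPrices rlo rhi := by
  refine ⟨h.nonneg, fun i t => ?_, h.sum_peak⟩
  have hstat : deriv (C.v i t) (x (i, t)) - C.p t = (C.Atildeᵀ *ᵥ π.ofLp) (i, t) :=
    C.adjoint_constraintCLM_apply π (i, t) ▸ congrArg (fun g : Alloc N T => g (i, t)) h.stationary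
  exact sub_eq_iff_eq_add.1 hstat ▸ (hr.mem_Icc x h.mem_feasible i t).2

theorem isClosed_properPrices (C : EnergyCommunity N T L) (rlo rhi : Fin N → Fin T → ℝ) :
    IsClosed (C.properPrices rlo rhi) := by
  simp only [properPrices, transpose_mulVec_apply, Set.mem_Icc, Set.ofPred_and,
    Set.ofPred_forall]
  refine (isClosed_iInter fun j => isClosed_le (by fun_prop) (by fun_prop)).inter
    ((isClosed_iInter fun i => isClosed_iInter fun t => ?_).inter
      (isClosed_eq (by fun_prop) (by fun_prop)))
  exact (isClosed_le (by fun_prop) (by fun_prop)).inter (isClosed_le (by fun_prop) (by fun_prop))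

theorem convex_properPrices (C : EnergyCommunity N T L) (rlo rhi : Fin N → Fin T → ℝ) :
    Convex ℝ (C.properPrices rlo rhi) := by
  rintro π ⟨hπ, hπIcc, hπsum⟩ ρ ⟨hρ, hρIcc, hρsum⟩ a b ha hb hab
  refine ⟨fun j => add_nonneg (mul_nonneg ha (hπ j)) (mul_nonneg hb (hρ j)), fun i t => ?_, ?_⟩
  · convert convex_Icc (rlo i t) (rhi i t) (hπIcc i t) (hρIcc i t) ha hb hab using 1
    simp only [WithLp.ofLp_add, WithLp.ofLp_smul, Matrix.mulVec_add, Matrix.mulVec_smul,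
      Pi.add_apply, Pi.smul_apply, smul_eq_mul]
    linear_combination -C.p t * hab
  · simp only [PiLp.add_apply, PiLp.smul_apply, smul_eq_mul, Finset.sum_add_distrib,
      ← Finset.mul_sum, hπsum, hρsum, ← add_mul, hab, one_mul]

theorem mul_norm_sq_demandVec_sub_le (hC : C.DifferentiableUtilities)
    (hr : C.PriceBounds rlo rhi) (hf : StrongConcaveOn C.allocDom δ C.objective) {π ρ : Price T L}
    (hπ : π ∈ C.properPrices rlo rhi) (hρ : ρ ∈ C.properPrices rlo rhi) :
    δ * ‖C.demandVec π - C.demandVec ρ‖ ^ 2 ≤ ⟪C.dualGrad π - C.dualGrad ρ, π - ρ⟫ := by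
  obtain ⟨hπdom, hπgrad⟩ := demandVec_spec hr hπ
  obtain ⟨hρdom, hρgrad⟩ := demandVec_spec hr hρ
  have h := inner_gradient_sub_le_of_strongConcaveOn hf hπdom hρdom
    (hasGradientAt_objective hC hπdom) (hasGradientAt_objective hC hρdom)
  rw [hπgrad, hρgrad, ← map_sub, ContinuousLinearMap.adjoint_inner_left, real_inner_comm] at h
  rw [dualGrad_sub, inner_neg_left]
  linarith

theorem cocoerciveOn_dualGrad (hC : C.DifferentiableUtilities) (hr : C.PriceBounds rlo rhi)
    (hδ : 0 ≤ δ) (hf : StrongConcaveOn C.allocDom δ C.objective) :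
    CocoerciveOn (C.properPrices rlo rhi) (δ / C.normAtilde ^ 2) C.dualGrad := by
  intro π hπ ρ hρ
  refine le_trans ?_ (mul_norm_sq_demandVec_sub_le hC hr hf hπ hρ)
  have hop : ‖C.dualGrad π - C.dualGrad ρ‖ ^ 2
      ≤ C.normAtilde ^ 2 * ‖C.demandVec π - C.demandVec ρ‖ ^ 2 := by
    rw [dualGrad_sub, norm_neg, ← mul_pow]
    exact pow_le_pow_left₀ (norm_nonneg _) (C.constraintCLM.le_opNorm _) 2
  calc δ / C.normAtilde ^ 2 * ‖C.dualGrad π - C.dualGrad ρ‖ ^ 2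
      ≤ δ / C.normAtilde ^ 2 * (C.normAtilde ^ 2 * ‖C.demandVec π - C.demandVec ρ‖ ^ 2) := by
        gcongr
    _ = δ * (C.normAtilde ^ 2 / C.normAtilde ^ 2) * ‖C.demandVec π - C.demandVec ρ‖ ^ 2 := by
        ring
    _ ≤ δ * 1 * ‖C.demandVec π - C.demandVec ρ‖ ^ 2 := by
        gcongr
        exact div_self_le_one _
    _ = δ * ‖C.demandVec π - C.demandVec ρ‖ ^ 2 := by rw [mul_one]

theorem continuousOn_demandVec (hC : C.DifferentiableUtilities) (hr : C.PriceBounds rlo rhi)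
    (hδ : 0 < δ) (hf : StrongConcaveOn C.allocDom δ C.objective) :
    ContinuousOn C.demandVec (C.properPrices rlo rhi) := by
  refine (LipschitzOnWith.of_dist_le_mul (K := ‖C.constraintCLM†‖₊ / δ.toNNReal)
    fun π hπ ρ hρ => ?_).continuousOn
  obtain ⟨hπdom, hπgrad⟩ := demandVec_spec hr hπ
  obtain ⟨hρdom, hρgrad⟩ := demandVec_spec hr hρ
  have h := mul_norm_sub_le_norm_objectiveGrad_sub hC hf hπdom hρdom
  rw [hπgrad, hρgrad, ← map_sub] at h
  rw [dist_eq_norm, dist_eq_norm, NNReal.coe_div, Real.coe_toNNReal δ hδ.le, coe_nnnorm,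
    div_mul_eq_mul_div, le_div_iff₀' hδ]
  exact h.trans (ContinuousLinearMap.le_opNorm _ _)

theorem inner_slack_sub (C : EnergyCommunity N T L) {π ρ : Price T L} (x : Alloc N T)
    (hsum : ∑ t, π (Sum.inr t) = ∑ t, ρ (Sum.inr t)) :
    ⟪π, C.slack x⟫ - ⟪ρ, C.slack x⟫ = ⟪C.bound - C.constraintCLM x, π - ρ⟫ := by
  rw [inner_slack, inner_slack, hsum, add_sub_add_right_eq_sub, ← inner_sub_left, real_inner_comm]

theorem IsKKT.projStep_dualGrad_eq_self_iff (hC : C.DifferentiableUtilities)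
    (hr : C.PriceBounds rlo rhi) (hδ : 0 < δ) (hf : StrongConcaveOn C.allocDom δ C.objective)
    {π ρ : Price T L} {x : Alloc N T} (h : C.IsKKT π x) (hρ : ρ ∈ C.properPrices rlo rhi)
    {α : ℝ} (hα : 0 < α) :
    projStep (C.properPrices rlo rhi) α C.dualGrad ρ = ρ ↔ C.IsKKT ρ x := by
  rw [projStep_eq_self_iff (C.isClosed_properPrices rlo rhi).isComplete
    (C.convex_properPrices rlo rhi) hα hρ]
  have hvi {π ρ : Price T L} (hπ : C.IsKKT π x) (hρ : ρ ∈ C.properPrices rlo rhi) :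
      ⟪C.dualGrad π, ρ - π⟫ = ⟪ρ, C.slack x⟫ := by
    rw [dualGrad, demandVec_eq hC hr hδ hf (hπ.mem_properPrices hr) hπ.mem_allocDom hπ.stationary,
      ← inner_slack_sub C x (hρ.2.2.trans hπ.sum_peak.symm), hπ.complementary, sub_zero]
  refine ⟨fun hfix => ?_, fun hk z hz => ?_⟩
  · have hπ := h.mem_properPrices hr
    have hnonneg := inner_slack_nonneg hρ.1 h.mem_feasible
    have hgap : δ * ‖C.demandVec ρ - x‖ ^ 2 + ⟪ρ, C.slack x⟫ ≤ 0 := by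
      have hmono := mul_norm_sq_demandVec_sub_le hC hr hf hρ hπ
      rw [inner_sub_left, hvi h hρ, ← neg_sub π ρ, inner_neg_right,
        demandVec_eq hC hr hδ hf hπ h.mem_allocDom h.stationary] at hmono
      linarith [hfix π hπ]
    have hsq : ‖C.demandVec ρ - x‖ ^ 2 = 0 :=
      le_antisymm (nonpos_of_mul_nonpos_right (by linarith) hδ) (sq_nonneg _)
    have hx : C.demandVec ρ = x := sub_eq_zero.1 (norm_eq_zero.1 (sq_eq_zero_iff.1 hsq))
    refine ⟨h.mem_allocDom, h.mem_feasible, hρ.1, hρ.2.2, hx ▸ (demandVec_spec hr hρ).2, ?_⟩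
    exact le_antisymm (by rw [hsq] at hgap; linarith) hnonneg
  · rw [hvi hk hz]
    exact inner_slack_nonneg hz.1 h.mem_feasible

/-! ### The learning algorithm -/

theorem tentativePrice_stateOf (C : EnergyCommunity N T L) (α : ℝ) (π : Price T L) (i : Fin N) :
    C.tentativePrice α (C.stateOf fun _ => π) i = π - α • C.dualGrad π := by
  ext (l | t)
  · simp [tentativePrice, stateOf, dualGrad, bound, demandVec, Matrix.mulVec, dotProduct,
      Fintype.sum_prod_type]
  · simp [tentativePrice, stateOf, dualGrad, bound, demandVec, load]

theorem learnLoop_eq_iterate (C : EnergyCommunity N T L) (P : Set (Price T L)) (α : ℝ) (k : ℕ)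
    (S : LearnState N T L) : C.learnLoop P α k S = (C.learnStep P α)^[k] S := by
  induction k generalizing S with
  | zero => rfl
  | succ k ih =>
    rw [learnLoop, iterate_succ_apply]
    split_ifs with h
    · rw [h, iterate_fixed h]
    · exact ih _

theorem learnRun_eq (C : EnergyCommunity N T L) (P : Set (Price T L)) (α : ℝ) (π₀ : Price T L)
    (K : ℕ) :
    C.learnRun P α π₀ K = C.stateOf fun _ => (projStep P α C.dualGrad)^[K] π₀ := by
  have hsemi : Semiconj (fun π => C.stateOf fun _ : Fin N => π) (projStep P α C.dualGrad)
      (C.learnStep P α) := fun π => by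
    simp only [learnStep, tentativePrice_stateOf, projStep]
  rw [learnRun, learnLoop_eq_iterate]
  exact ((hsemi.iterate_right K).eq π₀).symm

theorem learnRun_price (C : EnergyCommunity N T L) (P : Set (Price T L)) (α : ℝ)
    (π₀ : Price T L) (K : ℕ) (i : Fin N) :
    (C.learnRun P α π₀ K).price i = (projStep P α C.dualGrad)^[K] π₀ := by
  rw [learnRun_eq]
  rfl

/-- The profile in which all users announce the prices `π`, the demands are `x`, and all proxies
are correct. -/
def profileOf (π : Price T L) (x : Alloc N T) : Profile N T L := fun i =>
  (fun t => x (i, t), fun l => π (Sum.inl l), fun t => π (Sum.inr t),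
    fun t => x (finRotate N i, t))

theorem continuous_profileOf :
    Continuous fun z : Price T L × Alloc N T => profileOf z.1 z.2 := by
  unfold profileOf
  fun_prop

theorem learnProfile_eq (C : EnergyCommunity N T L) (P : Set (Price T L)) (α : ℝ)
    (π₀ : Price T L) (K : ℕ) :
    C.learnProfile P α π₀ K = profileOf ((projStep P α C.dualGrad)^[K] π₀)
      (C.demandVec ((projStep P α C.dualGrad)^[K] π₀)) := by
  funext i
  rw [learnProfile, learnRun_eq]
  rfl

/-! ### Nash equilibria -/

/-- The price vector announced in a message. -/
noncomputable def msgPrice (m : Msg T L) : Price T L := WithLp.toLp 2 (Sum.elim m.q m.s)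

/-- What user `i` pays for the demand `y` at the price vector `π`. -/
noncomputable def payment (C : EnergyCommunity N T L) (π : Price T L) (i : Fin N)
    (y : Fin T → ℝ) : ℝ :=
  ∑ t, ((C.Atildeᵀ *ᵥ π.ofLp) (i, t) + C.p t) * y t

theorem finRotate_ne_self (hN : 2 ≤ N) (i : Fin N) : finRotate N i ≠ i := by
  obtain ⟨n, rfl⟩ := Nat.exists_eq_add_of_le' hN
  rw [finRotate_apply]
  simp

theorem sum_erase_div_eq (hN : 2 ≤ N) {i : Fin N} {g : Fin N → ℝ} {c : ℝ}
    (hg : ∀ j ≠ i, g j = c) : (∑ j ∈ Finset.univ.erase i, g j) / ((N : ℝ) - 1) = c := by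
  have hN' : (2 : ℝ) ≤ N := by exact_mod_cast hN
  rw [Finset.sum_congr rfl fun j hj => hg j (Finset.ne_of_mem_erase hj), Finset.sum_const,
    Finset.card_erase_of_mem (Finset.mem_univ i), Finset.card_univ, Fintype.card_fin,
    nsmul_eq_mul, Nat.cast_pred (by lia)]
  exact mul_div_cancel_left₀ _ (by linarith)

section Deviation

variable {π : Price T L} {x : Alloc N T} {m : Profile N T L} {i : Fin N}

theorem sOthers_eq (hN : 2 ≤ N) (hm : ∀ j ≠ i, m j = profileOf π x j) :
    sOthers m i = fun t => π (Sum.inr t) :=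
  funext fun _ => sum_erase_div_eq hN fun j hj => by rw [hm j hj]; rfl

theorem qOthers_eq (hN : 2 ≤ N) (hm : ∀ j ≠ i, m j = profileOf π x j) :
    qOthers m i = fun l => π (Sum.inl l) :=
  funext fun _ => sum_erase_div_eq hN fun j hj => by rw [hm j hj]; rfl

theorem proxy_eq (hN : 2 ≤ N) (hm : ∀ j ≠ i, m j = profileOf π x j) :
    proxy m i = fun t => x (i, t) := by
  have hne : (finRotate N).symm i ≠ i := fun h =>
    finRotate_ne_self hN i ((Equiv.symm_apply_eq _).1 h).symm
  rw [proxy, hm _ hne]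
  simp only [profileOf, Msg.β, Equiv.apply_symm_apply]

theorem zeta_eq (hN : 2 ≤ N) (hm : ∀ j ≠ i, m j = profileOf π x j) : zeta m i = load x := by
  funext t
  rw [zeta, proxy_eq hN hm, load, ← Finset.sum_erase_add _ _ (Finset.mem_univ i)]
  congr 1
  exact Finset.sum_congr rfl fun j hj => by rw [hm j (Finset.ne_of_mem_erase hj)]; rfl

theorem constraint_surplus_eq (C : EnergyCommunity N T L) (hN : 2 ≤ N)
    (hm : ∀ j ≠ i, m j = profileOf π x j) (l : Fin L) :
    C.b l - ∑ j ∈ Finset.univ.erase i, ∑ t, C.A l (j, t) * (m j).y t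
      - ∑ t, C.A l (i, t) * proxy m i t = C.b l - (C.A *ᵥ x.ofLp) l := by
  rw [proxy_eq hN hm, sub_sub, Matrix.mulVec, dotProduct, Fintype.sum_prod_type,
    ← Finset.sum_erase_add _ _ (Finset.mem_univ i)]
  congr 2
  exact Finset.sum_congr rfl fun j hj => by rw [hm j (Finset.ne_of_mem_erase hj)]; rfl

theorem radialPrice_eq (hπ : ∀ j, 0 ≤ π j) (hsum : ∑ t, π (Sum.inr t) = C.p0) (z : Fin T → ℝ)
    (t : Fin T) : C.radialPrice (fun t => π (Sum.inr t)) z t = π (Sum.inr t) := by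
  by_cases hs : (fun t => π (Sum.inr t)) = 0
  · have hp0 : C.p0 = 0 := hsum ▸ Finset.sum_eq_zero fun t _ => congrFun hs t
    simp [radialPrice, hs, hp0, congrFun hs t]
  · have hne : C.p0 ≠ 0 := fun h => hs (funext fun t =>
      (Finset.sum_eq_zero_iff_of_nonneg fun t _ => hπ (Sum.inr t)).1 (hsum.trans h) t
        (Finset.mem_univ t))
    rw [radialPrice, if_pos hs, hsum, div_mul_cancel₀ _ hne]

theorem sum_price_mul_eq_payment (C : EnergyCommunity N T L) (π : Price T L) (i : Fin N)
    (y : Fin T → ℝ) :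
    ∑ t, (C.p t + π (Sum.inr t)) * y t + ∑ l, π (Sum.inl l) * ∑ t, C.A l (i, t) * y t
      = C.payment π i y := by
  simp only [payment, transpose_mulVec_apply, Finset.mul_sum, add_mul, Finset.sum_mul,
    Finset.sum_add_distrib]
  rw [Finset.sum_comm]
  simp only [mul_left_comm (π _), mul_assoc]
  ring

theorem tax_eq (hN : 2 ≤ N) (hπ : ∀ j, 0 ≤ π j) (hsum : ∑ t, π (Sum.inr t) = C.p0)
    (hm : ∀ j ≠ i, m j = profileOf π x j) :
    C.tax m i = C.payment π i (m i).y + ∑ t, ((m i).β t - x (finRotate N i, t)) ^ 2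
      + ‖msgPrice (m i) - π‖ ^ 2 + ⟪msgPrice (m i), C.slack x⟫ := by
  have hy : (m (finRotate N i)).y = fun t => x (finRotate N i, t) := by
    rw [hm _ (finRotate_ne_self hN i)]; rfl
  rw [tax, hy]
  simp only [constraint_surplus_eq C hN hm, sOthers_eq hN hm, qOthers_eq hN hm, zeta_eq hN hm,
    radialPrice_eq hπ hsum, sum_price_mul_eq_payment, EuclideanSpace.real_norm_sq_eq, inner_price,
    slack, peak, msgPrice, Fintype.sum_sum_type, PiLp.sub_apply, Sum.elim_inl, Sum.elim_inr,
    Finset.sum_add_distrib]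
  ring

end Deviation

theorem objective_sub_inner_adjoint (C : EnergyCommunity N T L) (π : Price T L) (x : Alloc N T) :
    C.objective x - ⟪(C.constraintCLM†) π, x⟫
      = ∑ i, (∑ t, C.v i t (x (i, t)) - C.payment π i fun t => x (i, t)) := by
  simp only [objective, payment, PiLp.inner_apply, adjoint_constraintCLM_apply,
    Fintype.sum_prod_type, ← Finset.sum_sub_distrib]
  refine Finset.sum_congr rfl fun i _ => Finset.sum_congr rfl fun t _ => ?_
  rw [RCLike.inner_apply, conj_trivial]
  ring

theorem sum_utility_sub_payment_le (hC : C.DifferentiableUtilities)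
    (hf : ConcaveOn ℝ C.allocDom C.objective) {π : Price T L} {x : Alloc N T}
    (hx : x ∈ C.allocDom) (hstat : C.objectiveGrad x = (C.constraintCLM†) π) {i : Fin N}
    {y : Fin T → ℝ} (hy : ∀ t, y t ∈ C.dom i t) :
    ∑ t, C.v i t (y t) - C.payment π i y
      ≤ ∑ t, C.v i t (x (i, t)) - C.payment π i fun t => x (i, t) := by
  classical
  let z : Alloc N T := WithLp.toLp 2 fun j => if j.1 = i then y j.2 else x j
  have hz : z ∈ C.allocDom := fun j t => by
    by_cases hj : j = i
    · subst hj
      simpa [z] using hy t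
    · simpa [z, hj] using hx j t
  have htangent := le_gradient_of_strongConcaveOn (strongConcaveOn_zero.2 hf) hx hz
    (hasGradientAt_objective hC hx)
  rw [hstat, inner_sub_right] at htangent
  have hsum : C.objective z - ⟪(C.constraintCLM†) π, z⟫
      ≤ C.objective x - ⟪(C.constraintCLM†) π, x⟫ := by linarith
  rw [objective_sub_inner_adjoint, objective_sub_inner_adjoint,
    ← Finset.add_sum_erase _ _ (Finset.mem_univ i),
    ← Finset.add_sum_erase (a := i) _ _ (Finset.mem_univ i)] at hsum
  have hself : (fun t => z (i, t)) = y := funext fun _ => if_pos rfl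
  have hothers : ∀ j ∈ Finset.univ.erase i,
      ∑ t, C.v j t (z (j, t)) - (C.payment π j fun t => z (j, t))
        = ∑ t, C.v j t (x (j, t)) - (C.payment π j fun t => x (j, t)) := fun j hj => by
    have hrow (t : Fin T) : z (j, t) = x (j, t) := if_neg (Finset.ne_of_mem_erase hj)
    simp only [hrow]
  rw [Finset.sum_congr rfl hothers, hself] at hsum
  simpa only [congrFun hself] using le_of_add_le_add_right hsum

theorem IsKKT.isNash (hN : 2 ≤ N) (hC : C.DifferentiableUtilities)
    (hf : ConcaveOn ℝ C.allocDom C.objective) {π : Price T L} {x : Alloc N T}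
    (h : C.IsKKT π x) : C.IsNash (profileOf π x) := by
  refine ⟨fun i => ⟨fun l => h.nonneg _, fun t => h.nonneg _⟩, fun i m' hm' => ?_⟩
  have hdom : ∀ t, (profileOf π x i).y t ∈ C.dom i t := h.mem_allocDom i
  have htruthful : C.tax (profileOf π x) i = C.payment π i fun t => x (i, t) := by
    have hmsg : msgPrice (profileOf π x i) = π := by ext (l | t) <;> rfl
    rw [tax_eq hN h.nonneg h.sum_peak fun _ _ => rfl, hmsg, h.complementary]
    simp [profileOf, Msg.y, Msg.β]
  have htax : C.payment π i m'.y ≤ C.tax (update (profileOf π x) i m') i := by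
    have hprice : ∀ j, 0 ≤ msgPrice m' j := Sum.rec hm'.1 hm'.2
    rw [tax_eq hN h.nonneg h.sum_peak fun j hj => update_of_ne hj _ _, update_self]
    have hproxy : 0 ≤ ∑ t, (m'.β t - x (finRotate N i, t)) ^ 2 :=
      Finset.sum_nonneg fun t _ => sq_nonneg _
    linarith [sq_nonneg ‖msgPrice m' - π‖, inner_slack_nonneg hprice h.mem_feasible]
  unfold payoff
  rw [if_pos hdom, update_self]
  split_ifs with hy
  · rw [EReal.coe_le_coe_iff, htruthful]
    exact (sub_le_sub_left htax _).trans
      (sum_utility_sub_payment_le hC hf h.mem_allocDom h.stationary hy)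
  · exact bot_le

theorem IsKKT.tendsto_learnProfile (hC : C.DifferentiableUtilities)
    (hr : C.PriceBounds rlo rhi) (hδ : 0 < δ) (hf : StrongConcaveOn C.allocDom δ C.objective)
    {α : ℝ} {a π₀ : Price T L} {x : Alloc N T} (h : C.IsKKT a x)
    (hπ₀ : π₀ ∈ C.properPrices rlo rhi)
    (hlim : Tendsto (fun k => (projStep (C.properPrices rlo rhi) α C.dualGrad)^[k] π₀) atTop
      (𝓝 a)) :
    Tendsto (C.learnProfile (C.properPrices rlo rhi) α π₀) atTop (𝓝 (profileOf a x)) := by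
  have haP := h.mem_properPrices hr
  have hmaps : Set.MapsTo (projStep (C.properPrices rlo rhi) α C.dualGrad) _ _ :=
    mapsTo_projStep (C.isClosed_properPrices rlo rhi).isComplete (C.convex_properPrices rlo rhi)
  have hdemand := (continuousOn_demandVec hC hr hδ hf a haP).tendsto.comp
    (tendsto_nhdsWithin_iff.2 ⟨hlim, Eventually.of_forall fun k => hmaps.iterate k hπ₀⟩)
  rw [demandVec_eq hC hr hδ hf haP h.mem_allocDom h.stationary] at hdemand
  rw [funext (C.learnProfile_eq _ α π₀)]
  exact (continuous_profileOf.tendsto (a, x)).comp (hlim.prodMk_nhds hdemand)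

end EnergyCommunity

theorem theorem6_general {N T L : ℕ} (hN : 2 ≤ N) (hT : 1 ≤ T) (C : EnergyCommunity N T L)
    (hC : C.DifferentiableUtilities) (hne : C.feasible.Nonempty)
    (rlo rhi : Fin N → Fin T → ℝ) (hr : C.PriceBounds rlo rhi)
    (δ' : ℝ) (hδ' : 0 < δ') (hf : StrongConcaveOn C.allocDom δ' C.objective)
    (α : ℝ) (hα : 0 < α) (hα' : α < 2 * δ' / C.normAtilde ^ 2)
    (π₀ : Price T L) (hπ₀ : π₀ ∈ C.properPrices rlo rhi) :
    (∀ π : Price T L, C.IsOptimalPrice π → ∀ i : Fin N,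
      Antitone fun K : ℕ =>
        dist ((C.learnRun (C.properPrices rlo rhi) α π₀ K).price i) π) ∧
    ∃ (m : Profile N T L) (π : Price T L), C.IsNash m ∧ C.IsOptimalPrice π ∧
      (∀ i, (∀ l, (m i).q l = π (Sum.inl l)) ∧ ∀ t, (m i).s t = π (Sum.inr t)) ∧
      Tendsto (C.learnProfile (C.properPrices rlo rhi) α π₀) atTop (𝓝 m) := by
  have hconcave : ConcaveOn ℝ C.allocDom C.objective :=
    strongConcaveOn_zero.1 (hf.mono hδ'.le)
  have hp0 : 0 ≤ C.p0 := hπ₀.2.2 ▸ Finset.sum_nonneg fun t _ => hπ₀.1 (Sum.inr t)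
  have hclosed := C.isClosed_properPrices rlo rhi
  have hcvx := C.convex_properPrices rlo rhi
  have hcoc := EnergyCommunity.cocoerciveOn_dualGrad hC hr hδ'.le hf
  rw [mul_div_assoc] at hα'
  obtain ⟨w, x, hw⟩ := EnergyCommunity.exists_isKKT hT hC hr hne hδ' hf hp0
  have hfix {π : Price T L} (hπ : π ∈ C.properPrices rlo rhi) :=
    hw.projStep_dualGrad_eq_self_iff hC hr hδ' hf hπ hα
  refine ⟨fun π hπ i => ?_, ?_⟩
  · have hkkt := (hw.isOptimalPrice_iff hC hconcave).1 hπ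
    have hπP := hkkt.mem_properPrices hr
    simpa only [C.learnRun_price] using hcoc.antitone_dist_iterate_projStep hclosed.isComplete
      hcvx hα.le hα'.le hπP ((hfix hπP).2 hkkt) hπ₀
  · have hwP := hw.mem_properPrices hr
    obtain ⟨a, haP, hfixa, hlim⟩ := hcoc.exists_tendsto_iterate_projStep hclosed hcvx hα.le hα'
      hwP ((hfix hwP).2 hw) hπ₀
    have ha : C.IsKKT a x := (hfix haP).1 hfixa
    refine ⟨EnergyCommunity.profileOf a x, a, ha.isNash hN hC hconcave,
      ha.isOptimalPrice hC hconcave, fun i => ⟨fun _ => rfl, fun _ => rfl⟩, ?_⟩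
    exact ha.tendsto_learnProfile hC hr hδ' hf hπ₀ hlim

theorem theorem6 {N T L : ℕ} (hN : 2 ≤ N) (hT : 1 ≤ T) (C : EnergyCommunity N T L)
    (δ : ℝ) (hδ : 0 < δ) (hC : C.Standing δ)
    (rlo rhi : Fin N → Fin T → ℝ) (hr : C.PriceBounds rlo rhi)
    (δ' : ℝ) (hδ' : 0 < δ') (hf : StrongConcaveOn C.allocDom δ' C.objective)
    (α : ℝ) (hα : 0 < α) (hα' : α < 2 * δ' / C.normAtilde ^ 2)
    (π₀ : Price T L) (hπ₀ : π₀ ∈ C.properPrices rlo rhi) :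
    (∀ π : Price T L, C.IsOptimalPrice π → ∀ i : Fin N,
      Antitone fun K : ℕ =>
        dist ((C.learnRun (C.properPrices rlo rhi) α π₀ K).price i) π) ∧
    ∃ (m : Profile N T L) (π : Price T L), C.IsNash m ∧ C.IsOptimalPrice π ∧
      (∀ i, (∀ l, (m i).q l = π (Sum.inl l)) ∧ ∀ t, (m i).s t = π (Sum.inr t)) ∧
      Filter.Tendsto (C.learnProfile (C.properPrices rlo rhi) α π₀) Filter.atTop (nhds m) := by
  refine theorem6_general hN hT C ⟨hC.isOpen_dom, hC.differentiable⟩ ⟨0, fun l => ?_⟩ rlo rhi hr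
    δ' hδ' hf α hα hα' π₀ hπ₀
  simpa using hC.b_nonneg l
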